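/- CTL formulas are built from propositions and the constants $\top,\bot$ by $\land,\lor,\lnot$ and the operators $\mathsf{P}\mathsf{T}\varphi$ and $\mathsf{P}[\varphi\,\mathsf{U}\,\psi]$ with $\mathsf P\in\{\mathsf A,\mathsf E\}$, $\mathsf T\in\{\mathsf X,\mathsf F,\mathsf G\}$. They are interpreted, with the usual path semantics, in Kripke structures with a finite set of worlds and a total successor relation; $\varphi$ is satisfiable if it holds at some world of such a structure. The temporal depth $\mathrm{td}(\varphi)$ is the maximal nesting depth of CTL-operators in $\varphi$. A formula is in negation normal form if $\lnot$ occurs only in front of propositions. Let $\tau$ be the finite relational vocabulary with the unary symbols $\mathrm{const}_\top,\mathrm{const}_\bot,\mathrm{var},\mathrm{repr},\mathrm{repr}_{\mathrm{PL}}$, and $\mathrm{repr}_{\mathsf C}$ for each CTL-operator $\mathsf C$; the binary symbols $\mathrm{conn}_{\land,1},\mathrm{conn}_{\land,2},\mathrm{conn}_{\lor,1},\mathrm{conn}_{\lor,2},\mathrm{conn}_{\lnot,1}$, and $\mathrm{body}_{\mathsf C}$ for each unary CTL-operator $\mathsf C$; and the ternary symbols $\mathrm{body}_{\mathsf C}$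 for $\mathsf C\in\{\mathsf{AU},\mathsf{EU}\}$. The $\tau$-structure $\mathcal A_\varphi$ has the set of subformulas of $\varphi$ (including $\varphi$) as its universe; $\mathrm{const}_f(x)$, $\mathrm{var}(x)$, $\mathrm{repr}(x)$, $\mathrm{repr}_{\mathrm{PL}}(x)$, $\mathrm{repr}_{\mathsf C}(x)$ hold iff $x$ is, respectively, the constant $f$, a proposition, the formula $\varphi$, a formula without CTL-operators, a formula with outermost operator $\mathsf C$; $\mathrm{conn}_{f,i}(x,y)$ holds iff $y$ has outermost connective $f$ and $x$ is its $i$-th argument; $\mathrm{body}_{\mathsf C}(y,x)$ holds iff $x=\mathsf C y$; and $\mathrm{body}_{\mathsf C}(y,z,x)$ holds iff $x=\mathsf C(y,z)$. More generally, a finite $\tau$-structure $\mathcal A$ encodes $\varphi$ if each of its elements represents a subformula of $\varphi$, each subformula is represented, $\varphi$ and each proposition are represented by only one element, the unary predicates hold as above for the represented formulas, and the relations $\mathrm{conn}_{f,i}$, $\mathrm{body}_{\mathsf C}$ relate each element whose formula has the outermost symbol $f$ or $\mathsf C$ to exactly one element (pair of elements, if $\mathsf C$ is binary) representing the corresponding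 argument(s), and contain no other tuples. For example, $\mathcal A_\varphi$ encodes $\varphi$, and so does the syntax tree of $\varphi$ with all leaves carrying the same proposition identified. **Lemma.** There is a computable sequence $(\theta_d)_{d\in\mathbb N}$ of sentences of monadic second-order logic over $\tau$ such that, for every CTL formula $\varphi$ in negation normal form whose only CTL-operators are $\mathsf{AX}$ and $\mathsf{EX}$, $$\varphi \text{ is satisfiable}\iff \mathcal A_\varphi\models\theta_{\mathrm{td}(\varphi)},$$ and likewise $\varphi$ is satisfiable iff $\mathcal A\models\theta_{\mathrm{td}(\varphi)}$, for every finite $\tau$-structure $\mathcal A$ that encodes $\varphi$. -/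

import Mathlib

namespace CTL

/-! ### Formulas of computation tree logic -/

/-- Path quantifiers: all paths, some path. -/
inductive PathQ
  | A
  | E

/-- Unary temporal operators: next, future, globally. -/
inductive TempOp
  | X
  | F
  | G

/-- CTL formulas over the propositions `0, 1, 2, …`. `un q t φ` is `q t φ` (for instance
`un .A .X φ` is `AX φ`) and `bin q φ ψ` is `q[φ U ψ]`. -/
inductive Formula
  | top
  | bot
  | var (p : ℕ)
  | neg (φ : Formula)
  | and (φ ψ : Formula)
  | or (φ ψ : Formula)
  | un (q : PathQ) (t : TempOp) (φ : Formula)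
  | bin (q : PathQ) (φ ψ : Formula)

/-- CTL-operators: a path quantifier followed by a temporal operator. -/
inductive Operator
  | un (q : PathQ) (t : TempOp)
  | untl (q : PathQ)

/-- The operator `AX`. -/
def opAX : Operator := .un .A .X

/-- The operator `EX`. -/
def opEX : Operator := .un .E .X

namespace Formula

/-- All CTL-operators that occur in the formula belong to `T`. -/
def UsesOnly (T : Set Operator) : Formula → Prop
  | top => True
  | bot => True
  | var _ => True
  | neg φ => φ.UsesOnly T
  | and φ ψ => φ.UsesOnly T ∧ ψ.UsesOnly T
  | or φ ψ => φ.UsesOnly T ∧ ψ.UsesOnly T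
  | un q t φ => Operator.un q t ∈ T ∧ φ.UsesOnly T
  | bin q φ ψ => Operator.untl q ∈ T ∧ φ.UsesOnly T ∧ ψ.UsesOnly T

/-- Negation normal form: negations occur only in front of propositions. -/
def IsNNF : Formula → Prop
  | top => True
  | bot => True
  | var _ => True
  | neg φ => ∃ p, φ = var p
  | and φ ψ => φ.IsNNF ∧ ψ.IsNNF
  | or φ ψ => φ.IsNNF ∧ ψ.IsNNF
  | un _ _ φ => φ.IsNNF
  | bin _ φ ψ => φ.IsNNF ∧ ψ.IsNNF

/-- Propositional formulas: no CTL-operator occurs. -/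
def IsPL (φ : Formula) : Prop := φ.UsesOnly ∅

/-- Temporal depth. -/
def td : Formula → ℕ
  | top => 0
  | bot => 0
  | var _ => 0
  | neg φ => φ.td
  | and φ ψ => max φ.td ψ.td
  | or φ ψ => max φ.td ψ.td
  | un _ _ φ => φ.td + 1
  | bin _ φ ψ => max φ.td ψ.td + 1

/-- The set of subformulas of a formula, the formula itself included. -/
def SF : Formula → Set Formula
  | top => {top}
  | bot => {bot}
  | var p => {var p}
  | neg φ => insert (neg φ) φ.SF
  | and φ ψ => insert (and φ ψ) (φ.SF ∪ ψ.SF)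
  | or φ ψ => insert (or φ ψ) (φ.SF ∪ ψ.SF)
  | un q t φ => insert (un q t φ) φ.SF
  | bin q φ ψ => insert (bin q φ ψ) (φ.SF ∪ ψ.SF)

theorem self_mem_SF (φ : Formula) : φ ∈ φ.SF := by
  cases φ <;> simp [SF]

theorem finite_SF (φ : Formula) : φ.SF.Finite := by
  induction φ <;> simp_all [SF]

theorem SF_trans {χ ψ φ : Formula} (h : χ ∈ ψ.SF) (h' : ψ ∈ φ.SF) : χ ∈ φ.SF := by
  induction φ <;> simp only [SF, Set.mem_insert_iff, Set.mem_union, Set.mem_singleton_iff] at h' ⊢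
    <;> grind [SF]

end Formula

/-- The fragment of CTL formulas in negation normal form that use only operators from `T`. -/
def NNF (T : Set Operator) : Set Formula := {φ | φ.IsNNF ∧ φ.UsesOnly T}

/-! ### Kripke semantics -/

/-- Kripke structures: finitely many worlds and a total successor relation. -/
structure Kripke where
  W : Type
  fin : Finite W
  R : W → W → Prop
  total : ∀ w, ∃ w', R w w'
  V : W → Set ℕ

/-- The infinite paths of `K` that start in `w`. -/
def Kripke.paths (K : Kripke) (w : K.W) : Set (ℕ → K.W) :=
  {π | π 0 = w ∧ ∀ i, K.R (π i) (π (i + 1))}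

/-- Quantification over a set of paths. -/
def PathQ.Holds {α : Type} : PathQ → Set α → (α → Prop) → Prop
  | A, S, P => ∀ π ∈ S, P π
  | E, S, P => ∃ π ∈ S, P π

/-- A temporal operator on a path, for an argument that holds exactly at the worlds in `P`. -/
def TempOp.Holds {W : Type} : TempOp → (W → Prop) → (ℕ → W) → Prop
  | X, P, π => P (π 1)
  | F, P, π => ∃ i, P (π i)
  | G, P, π => ∀ i, P (π i)

/-- `K.Sat φ w` is `K, w ⊨ φ`. -/
def Kripke.Sat (K : Kripke) : Formula → K.W → Prop
  | .top, _ => True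
  | .bot, _ => False
  | .var p, w => p ∈ K.V w
  | .neg φ, w => ¬ K.Sat φ w
  | .and φ ψ, w => K.Sat φ w ∧ K.Sat ψ w
  | .or φ ψ, w => K.Sat φ w ∨ K.Sat ψ w
  | .un q t φ, w => q.Holds (K.paths w) (fun π => t.Holds (fun v => K.Sat φ v) π)
  | .bin q φ ψ, w => q.Holds (K.paths w)
      (fun π => ∃ i, (∀ j < i, K.Sat φ (π j)) ∧ K.Sat ψ (π i))

/-- Satisfiability of a CTL formula. -/
def Formula.Satisfiable (φ : Formula) : Prop := ∃ (K : Kripke) (w : K.W), K.Sat φ w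

/-! ### The vocabulary and the structures that encode formulas -/

/-- Argument positions of the Boolean connectives. -/
inductive ConnPos
  | and₁
  | and₂
  | or₁
  | or₂
  | not₁

/-- The argument of a formula at a position of a connective, if that connective is at the root. -/
def ConnPos.arg : ConnPos → Formula → Option Formula
  | and₁, .and φ _ => some φ
  | and₂, .and _ ψ => some ψ
  | or₁, .or φ _ => some φ
  | or₂, .or _ ψ => some ψ
  | not₁, .neg φ => some φ
  | _, _ => none

/-- The constant true or false. -/
def constFormula : Bool → Formula
  | true => .top
  | false => .bot

/-- The relation symbols, indexed by their arity. -/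
inductive TauRel : ℕ → Type
  | const (b : Bool) : TauRel 1
  | var : TauRel 1
  | repr : TauRel 1
  | reprPL : TauRel 1
  | reprUn (q : PathQ) (t : TempOp) : TauRel 1
  | reprBin (q : PathQ) : TauRel 1
  | conn (c : ConnPos) : TauRel 2
  | bodyUn (q : PathQ) (t : TempOp) : TauRel 2
  | bodyBin (q : PathQ) : TauRel 3

/-- The (relational, finite) vocabulary of the encoding structures. -/
def tau : FirstOrder.Language := ⟨fun _ => Empty, TauRel⟩

/-- The meaning of the relation symbols on a set of elements `x`, each of which represents the
formula `x.1`, in the encoding of `φ`. -/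
def TauRel.Interp (φ : Formula) {S : Set Formula} : {n : ℕ} → TauRel n → (Fin n → S) → Prop
  | _, const b, a => (a 0).1 = constFormula b
  | _, var, a => ∃ p, (a 0).1 = .var p
  | _, repr, a => (a 0).1 = φ
  | _, reprPL, a => (a 0).1.IsPL
  | _, reprUn q t, a => ∃ ψ, (a 0).1 = .un q t ψ
  | _, reprBin q, a => ∃ ψ χ, (a 0).1 = .bin q ψ χ
  | _, conn c, a => c.arg (a 1).1 = some (a 0).1
  | _, bodyUn q t, a => (a 1).1 = .un q t (a 0).1
  | _, bodyBin q, a => (a 2).1 = .bin q (a 0).1 (a 1).1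

/-- The universe of the structure `A_φ`: the subformulas of `φ`. -/
def Formula.Univ (φ : Formula) : Type := φ.SF

/-- The structure `A_φ`. -/
instance (φ : Formula) : tau.Structure φ.Univ where
  funMap := fun f => Empty.elim f
  RelMap := fun r a => TauRel.Interp φ (S := φ.SF) r a

open FirstOrder.Language.Structure in
/-- The structure on `A` encodes `φ`, where the element `x` represents the formula `ρ x`. Several
elements may represent the same subformula (as in the syntax tree of `φ`), except that `φ` and each
proposition have only one representative. -/
structure IsEncoding (φ : Formula) (A : Type) [tau.Structure A] (ρ : A → Formula) : Prop where
  mem_SF : ∀ x, ρ x ∈ φ.SF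
  surj : ∀ ψ ∈ φ.SF, ∃ x, ρ x = ψ
  root_unique : ∀ x y, ρ x = φ → ρ y = φ → x = y
  var_unique : ∀ p x y, ρ x = .var p → ρ y = .var p → x = y
  const_iff : ∀ b x, RelMap (L := tau) (TauRel.const b) ![x] ↔ ρ x = constFormula b
  var_iff : ∀ x, RelMap (L := tau) TauRel.var ![x] ↔ ∃ p, ρ x = .var p
  repr_iff : ∀ x, RelMap (L := tau) TauRel.repr ![x] ↔ ρ x = φ
  reprPL_iff : ∀ x, RelMap (L := tau) TauRel.reprPL ![x] ↔ (ρ x).IsPL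
  reprUn_iff : ∀ q t x, RelMap (L := tau) (TauRel.reprUn q t) ![x] ↔ ∃ ψ, ρ x = .un q t ψ
  reprBin_iff : ∀ q x, RelMap (L := tau) (TauRel.reprBin q) ![x] ↔ ∃ ψ χ, ρ x = .bin q ψ χ
  conn_sound : ∀ c x y, RelMap (L := tau) (TauRel.conn c) ![x, y] → c.arg (ρ y) = some (ρ x)
  conn_complete : ∀ c y ψ, c.arg (ρ y) = some ψ → ∃! x, RelMap (L := tau) (TauRel.conn c) ![x, y]
  bodyUn_sound : ∀ q t y x, RelMap (L := tau) (TauRel.bodyUn q t) ![y, x] → ρ x = .un q t (ρ y)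
  bodyUn_complete : ∀ q t x ψ, ρ x = .un q t ψ →
    ∃! y, RelMap (L := tau) (TauRel.bodyUn q t) ![y, x]
  bodyBin_sound : ∀ q y z x, RelMap (L := tau) (TauRel.bodyBin q) ![y, z, x] →
    ρ x = .bin q (ρ y) (ρ z)
  bodyBin_complete : ∀ q x ψ χ, ρ x = .bin q ψ χ →
    ∃! yz : A × A, RelMap (L := tau) (TauRel.bodyBin q) ![yz.1, yz.2, x]

theorem finite_univ (φ : Formula) : Finite φ.Univ := φ.finite_SF.to_subtype

theorem arg_mem_SF {c : ConnPos} {φ ψ : Formula} (h : c.arg φ = some ψ) : ψ ∈ φ.SF := by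
  cases c <;> cases φ <;> simp_all [ConnPos.arg, Formula.SF, Formula.self_mem_SF]

/-- The structure `A_φ` is an encoding of `φ` in which each subformula represents itself. -/
theorem isEncoding_univ (φ : Formula) : IsEncoding φ φ.Univ Subtype.val where
  mem_SF x := x.2
  surj ψ h := ⟨⟨ψ, h⟩, rfl⟩
  root_unique x y h h' := Subtype.ext (h.trans h'.symm)
  var_unique p x y h h' := Subtype.ext (h.trans h'.symm)
  const_iff _ _ := Iff.rfl
  var_iff _ := Iff.rfl
  repr_iff _ := Iff.rfl
  reprPL_iff _ := Iff.rfl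
  reprUn_iff _ _ _ := Iff.rfl
  reprBin_iff _ _ := Iff.rfl
  conn_sound _ _ _ h := h
  conn_complete c y ψ h := ⟨⟨ψ, Formula.SF_trans (arg_mem_SF h) y.2⟩, h, fun z hz =>
    Subtype.ext (Option.some.inj ((show c.arg y.1 = some z.1 from hz).symm.trans h))⟩
  bodyUn_sound _ _ _ _ h := h
  bodyUn_complete q t x ψ h := ⟨⟨ψ, Formula.SF_trans
      (by rw [h]; simp [Formula.SF, Formula.self_mem_SF]) x.2⟩, h, fun z hz =>
    Subtype.ext (by
      have := (show x.1 = .un q t z.1 from hz).symm.trans h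
      simpa using this)⟩
  bodyBin_sound _ _ _ _ h := h
  bodyBin_complete q x ψ χ h := by
    have h1 : ψ ∈ φ.SF := Formula.SF_trans (by rw [h]; simp [Formula.SF, Formula.self_mem_SF]) x.2
    have h2 : χ ∈ φ.SF := Formula.SF_trans (by rw [h]; simp [Formula.SF, Formula.self_mem_SF]) x.2
    refine ⟨(⟨ψ, h1⟩, ⟨χ, h2⟩), h, fun z hz => ?_⟩
    have := (show x.1 = .bin q z.1.1 z.2.1 from hz).symm.trans h
    simp only [Formula.bin.injEq, true_and] at this
    exact Prod.ext (Subtype.ext this.1) (Subtype.ext this.2)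

end CTL

/-! ### Monadic second-order logic -/

/-- Formulas of monadic second-order logic over a relational vocabulary `L`, with element variables
`x₀, x₁, …` and set variables `X₀, X₁, …`. -/
inductive MSO (L : FirstOrder.Language)
  | rel {n : ℕ} (r : L.Relations n) (x : Fin n → ℕ)
  | eq (x y : ℕ)
  | mem (x X : ℕ)
  | neg (θ : MSO L)
  | and (θ η : MSO L)
  | or (θ η : MSO L)
  | ex (x : ℕ) (θ : MSO L)
  | all (x : ℕ) (θ : MSO L)
  | exSet (X : ℕ) (θ : MSO L)
  | allSet (X : ℕ) (θ : MSO L)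

namespace MSO

variable {L : FirstOrder.Language}

/-- Satisfaction under an assignment `v` of the element variables and `V` of the set variables. -/
def Sat (A : Type) [L.Structure A] : MSO L → (ℕ → A) → (ℕ → Set A) → Prop
  | rel r x, v, _ => FirstOrder.Language.Structure.RelMap r (fun i => v (x i))
  | eq x y, v, _ => v x = v y
  | mem x X, v, V => v x ∈ V X
  | neg θ, v, V => ¬ θ.Sat A v V
  | and θ η, v, V => θ.Sat A v V ∧ η.Sat A v V
  | or θ η, v, V => θ.Sat A v V ∨ η.Sat A v V
  | ex x θ, v, V => ∃ a : A, θ.Sat A (Function.update v x a) V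
  | all x θ, v, V => ∀ a : A, θ.Sat A (Function.update v x a) V
  | exSet X θ, v, V => ∃ S : Set A, θ.Sat A v (Function.update V X S)
  | allSet X θ, v, V => ∀ S : Set A, θ.Sat A v (Function.update V X S)

/-- The free element variables. -/
def freeVars : MSO L → Set ℕ
  | rel _ x => Set.range x
  | eq x y => {x, y}
  | mem x _ => {x}
  | neg θ => θ.freeVars
  | and θ η => θ.freeVars ∪ η.freeVars
  | or θ η => θ.freeVars ∪ η.freeVars
  | ex x θ => θ.freeVars \ {x}
  | all x θ => θ.freeVars \ {x}
  | exSet _ θ => θ.freeVars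
  | allSet _ θ => θ.freeVars

/-- The free set variables. -/
def freeSetVars : MSO L → Set ℕ
  | rel _ _ => ∅
  | eq _ _ => ∅
  | mem _ X => {X}
  | neg θ => θ.freeSetVars
  | and θ η => θ.freeSetVars ∪ η.freeSetVars
  | or θ η => θ.freeSetVars ∪ η.freeSetVars
  | ex _ θ => θ.freeSetVars
  | all _ θ => θ.freeSetVars
  | exSet X θ => θ.freeSetVars \ {X}
  | allSet X θ => θ.freeSetVars \ {X}

/-- Sentences: formulas without free variables. -/
def IsSentence (θ : MSO L) : Prop := θ.freeVars = ∅ ∧ θ.freeSetVars = ∅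

/-- `θ.HoldsIn A` is `A ⊨ θ`; for a sentence the assignments do not matter. -/
def HoldsIn (θ : MSO L) (A : Type) [L.Structure A] : Prop := ∀ v V, θ.Sat A v V

end MSO

/-! ### Gödel numbers of MSO formulas over the vocabulary `tau`, used to say that a family of
formulas is computable -/

namespace CTL

def PathQ.code : PathQ → ℕ
  | A => 0
  | E => 1

def TempOp.code : TempOp → ℕ
  | X => 0
  | F => 1
  | G => 2

def ConnPos.code : ConnPos → ℕ
  | and₁ => 0
  | and₂ => 1
  | or₁ => 2
  | or₂ => 3
  | not₁ => 4

def TauRel.code : {n : ℕ} → TauRel n → ℕ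
  | _, const b => Nat.pair 0 b.toNat
  | _, var => Nat.pair 1 0
  | _, repr => Nat.pair 2 0
  | _, reprPL => Nat.pair 3 0
  | _, reprUn q t => Nat.pair 4 (Nat.pair q.code t.code)
  | _, reprBin q => Nat.pair 5 q.code
  | _, conn c => Nat.pair 6 c.code
  | _, bodyUn q t => Nat.pair 7 (Nat.pair q.code t.code)
  | _, bodyBin q => Nat.pair 8 q.code

/-- The Gödel number of an MSO formula. -/
def msoCode : MSO tau → ℕ
  | @MSO.rel _ n r x =>
      Nat.pair 0 (Nat.pair n (Nat.pair (TauRel.code r) (Encodable.encode (List.ofFn x))))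
  | .eq x y => Nat.pair 1 (Nat.pair x y)
  | .mem x X => Nat.pair 2 (Nat.pair x X)
  | .neg θ => Nat.pair 3 (msoCode θ)
  | .and θ η => Nat.pair 4 (Nat.pair (msoCode θ) (msoCode η))
  | .or θ η => Nat.pair 5 (Nat.pair (msoCode θ) (msoCode η))
  | .ex x θ => Nat.pair 6 (Nat.pair x (msoCode θ))
  | .all x θ => Nat.pair 7 (Nat.pair x (msoCode θ))
  | .exSet X θ => Nat.pair 8 (Nat.pair X (msoCode θ))
  | .allSet X θ => Nat.pair 9 (Nat.pair X (msoCode θ))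

theorem TauRel.code_injective {n : ℕ} {r s : TauRel n} (h : r.code = s.code) : r = s := by
  have hq : ∀ q q' : PathQ, q.code = q'.code → q = q' := by
    intro q q'; cases q <;> cases q' <;> simp [PathQ.code]
  have ht : ∀ t t' : TempOp, t.code = t'.code → t = t' := by
    intro t t'; cases t <;> cases t' <;> simp [TempOp.code]
  have hc : ∀ c c' : ConnPos, c.code = c'.code → c = c' := by
    intro c c'; cases c <;> cases c' <;> simp [ConnPos.code]
  have hb : ∀ b b' : Bool, b.toNat = b'.toNat → b = b' := by decide
  cases r <;> cases s <;> simp [TauRel.code, Nat.pair_eq_pair] at h ⊢ <;> grind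

theorem msoCode_injective : Function.Injective msoCode := by
  intro θ
  induction θ with
  | rel r x =>
    intro η h
    cases η <;> simp [msoCode, Nat.pair_eq_pair] at h
    obtain ⟨rfl, hr, hx⟩ := h
    rw [TauRel.code_injective hr, List.ofFn_injective hx]
  | _ =>
    intro η h
    cases η <;> simp [msoCode, Nat.pair_eq_pair] at h ⊢ <;> grind

end CTL

namespace CTL

open FirstOrder.Language.Structure

/-! ### Semantics of the next-step operators -/

/-! The truths at a world form a set `T` of elements closed under the Boolean rules. Beyond these
rules, `T` constrains the rest of the model only through the successors: each true `EX`-formula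
needs some successor that satisfies its argument together with the arguments of all true
`AX`-formulas. No other formula has to hold there, and the demanded ones have smaller temporal
depth. Satisfiability at depth at most `d` is thus a game of `d + 1` rounds: guess a saturated `T`,
let the opponent choose the element `e` to be served, and continue with its demand. Each round is a
fixed block of MSO quantifiers, so `Consistent` unfolds into a sentence for each `d`.

A model yields winning guesses, namely the sets of truths (`IsEncoding.consistent`). Conversely,
models of the demands are joined below a new root whose valuation is read off from `T`
(`IsEncoding.exists_sat`). Normal form reduces negation to a check on propositions, and this check
is local because a proposition has only one representative.

Consistency passes to subsets, so quantifying over all `U` inside a demand says the same as naming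
the demand itself. -/

theorem Kripke.exists_path (K : Kripke) {w v : K.W} (h : K.R w v) :
    ∃ π ∈ K.paths w, π 1 = v := by
  -- Totality extends the single step from `w` to `v` to an infinite path by iterating a choice of
  -- successors.
  choose f hf using K.total
  refine ⟨fun n => Nat.casesOn n w (fun n => f^[n] v), ⟨rfl, fun i => ?_⟩, rfl⟩
  cases i with
  | zero => exact h
  | succ i =>
    simp only [Function.iterate_succ_apply']
    exact hf _

theorem Kripke.sat_AX (K : Kripke) (φ : Formula) (w : K.W) :
    K.Sat (.un .A .X φ) w ↔ ∀ v, K.R w v → K.Sat φ v := by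
  constructor
  · intro h v hv
    obtain ⟨π, hπ, rfl⟩ := K.exists_path hv
    exact h π hπ
  · intro h π hπ
    exact h _ (hπ.1 ▸ hπ.2 0)

theorem Kripke.sat_EX (K : Kripke) (φ : Formula) (w : K.W) :
    K.Sat (.un .E .X φ) w ↔ ∃ v, K.R w v ∧ K.Sat φ v := by
  constructor
  · rintro ⟨π, hπ, h⟩
    exact ⟨π 1, hπ.1 ▸ hπ.2 0, h⟩
  · rintro ⟨v, hv, h⟩
    obtain ⟨π, hπ, rfl⟩ := K.exists_path hv
    exact ⟨π, hπ, h⟩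

/-- A unary operator in a formula over `AX`, `EX` is one of these two. -/
theorem Formula.UsesOnly.un_cases {q : PathQ} {t : TempOp} {φ : Formula}
    (h : (Formula.un q t φ).UsesOnly {opAX, opEX}) : (q = .A ∨ q = .E) ∧ t = .X := by
  have := h.1
  simp only [opAX, opEX, Set.mem_insert_iff, Set.mem_singleton_iff, Operator.un.injEq] at this
  tauto

theorem Formula.UsesOnly.not_bin {q : PathQ} {φ ψ : Formula} :
    ¬ (Formula.bin q φ ψ).UsesOnly {opAX, opEX} := by
  intro h
  have := h.1
  simp [opAX, opEX] at this

/-- Truth of formulas over `AX`, `EX` is invariant under embeddings as a generated substructure. -/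
theorem Kripke.sat_map_iff {K K' : Kripke} (f : K.W → K'.W)
    (hR : ∀ w v, K'.R (f w) v ↔ ∃ u, K.R w u ∧ f u = v) (hV : ∀ w, K'.V (f w) = K.V w)
    {φ : Formula} (hφ : φ.UsesOnly {opAX, opEX}) (w : K.W) :
    K'.Sat φ (f w) ↔ K.Sat φ w := by
  induction φ generalizing w with
  | top => simp [Kripke.Sat]
  | bot => simp [Kripke.Sat]
  | var p => simp [Kripke.Sat, hV]
  | neg φ ih => simp only [Kripke.Sat, ih hφ]
  | and φ ψ ih ih' => simp only [Kripke.Sat, ih hφ.1, ih' hφ.2]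
  | or φ ψ ih ih' => simp only [Kripke.Sat, ih hφ.1, ih' hφ.2]
  | un q t φ ih =>
    obtain ⟨rfl | rfl, rfl⟩ := hφ.un_cases
    · simp only [sat_AX, hR]
      constructor
      · exact fun h u hu => (ih hφ.2 u).1 (h _ ⟨u, hu, rfl⟩)
      · rintro h _ ⟨u, hu, rfl⟩
        exact (ih hφ.2 u).2 (h u hu)
    · simp only [sat_EX, hR]
      constructor
      · rintro ⟨_, ⟨u, hu, rfl⟩, h⟩
        exact ⟨u, hu, (ih hφ.2 u).1 h⟩
      · rintro ⟨u, hu, h⟩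
        exact ⟨_, ⟨u, hu, rfl⟩, (ih hφ.2 u).2 h⟩
  | bin q φ ψ => exact absurd hφ Formula.UsesOnly.not_bin

/-- The disjoint union of the structures `K i`, together with a new root that satisfies the
propositions in `P` and has the worlds `w i` as its successors. -/
def Kripke.join {ι : Type} [Finite ι] [Nonempty ι] (K : ι → Kripke) (w : ∀ i, (K i).W)
    (P : Set ℕ) : Kripke where
  W := Option (Σ i, (K i).W)
  fin := by
    have := fun i => (K i).fin
    infer_instance
  R
    | none, v => ∃ i, v = some ⟨i, w i⟩
    | some u, v => ∃ u', (K u.1).R u.2 u' ∧ some ⟨u.1, u'⟩ = v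
  total
    | none => ⟨_, Classical.arbitrary ι, rfl⟩
    | some u => by
      obtain ⟨u', h⟩ := (K u.1).total u.2
      exact ⟨_, u', h, rfl⟩
  V
    | none => P
    | some u => (K u.1).V u.2

theorem Kripke.sat_join_iff {ι : Type} [Finite ι] [Nonempty ι] (K : ι → Kripke)
    (w : ∀ i, (K i).W) (P : Set ℕ) {φ : Formula} (hφ : φ.UsesOnly {opAX, opEX}) (i : ι)
    (u : (K i).W) : (Kripke.join K w P).Sat φ (some ⟨i, u⟩) ↔ (K i).Sat φ u :=
  Kripke.sat_map_iff (K' := Kripke.join K w P) (fun u => some ⟨i, u⟩)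
    (fun _ _ => Iff.rfl) (fun _ => rfl) hφ u

/-! ### Subformulas -/

theorem Formula.IsNNF.of_mem_SF {φ ψ : Formula} (h : φ.IsNNF) (hψ : ψ ∈ φ.SF) : ψ.IsNNF := by
  induction φ <;> simp only [SF, Set.mem_insert_iff, Set.mem_union, Set.mem_singleton_iff] at hψ
    <;> grind [IsNNF, SF]

theorem Formula.UsesOnly.of_mem_SF {T : Set Operator} {φ ψ : Formula} (h : φ.UsesOnly T)
    (hψ : ψ ∈ φ.SF) : ψ.UsesOnly T := by
  induction φ <;> simp only [SF, Set.mem_insert_iff, Set.mem_union, Set.mem_singleton_iff] at hψ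
    <;> grind [UsesOnly]

/-! ### Consistent sets of elements -/

section Consistent

variable (A : Type) [tau.Structure A]

/-- `T` is closed under the rules for the Boolean connectives and contains no contradiction. -/
structure IsSaturated (T : Set A) : Prop where
  bot : ∀ x ∈ T, ¬ RelMap (L := tau) (TauRel.const false) ![x]
  and₁ : ∀ x ∈ T, ∀ y, RelMap (L := tau) (TauRel.conn .and₁) ![y, x] → y ∈ T
  and₂ : ∀ x ∈ T, ∀ y, RelMap (L := tau) (TauRel.conn .and₂) ![y, x] → y ∈ T
  or : ∀ x ∈ T, ∀ y z, RelMap (L := tau) (TauRel.conn .or₁) ![y, x] →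
    RelMap (L := tau) (TauRel.conn .or₂) ![z, x] → y ∈ T ∨ z ∈ T
  neg : ∀ x ∈ T, ∀ y, RelMap (L := tau) (TauRel.conn .not₁) ![y, x] → y ∉ T

/-- The arguments of the `AX`-elements of `T`, and of `e` if `e` is an `EX`-element of `T`: what
`T` demands of the successor that is responsible for `e`. -/
def demand (T : Set A) (e : A) : Set A :=
  {y | (∃ x ∈ T, RelMap (L := tau) (TauRel.bodyUn .A .X) ![y, x]) ∨
    (e ∈ T ∧ RelMap (L := tau) (TauRel.bodyUn .E .X) ![y, e])}

/-- The elements of `S` are jointly satisfiable and represent formulas of temporal depth less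
than `d`. -/
def Consistent : ℕ → Set A → Prop
  | 0, S => S = ∅
  | d + 1, S => ∃ T, S ⊆ T ∧ IsSaturated A T ∧
      ∀ U, (∃ e, U ⊆ demand A T e) → Consistent d U

variable {A} {φ : Formula} {ρ : A → Formula}

/-- At each round the guess is the set of all elements true at the current world within the depth
bound. The strict bound makes depth `0` force the empty set, and passing to an argument of a
next-step operator lowers it by one. -/
theorem IsEncoding.consistent (hρ : IsEncoding φ A ρ) (K : Kripke) {d : ℕ} {S : Set A} {w : K.W}
    (hS : ∀ x ∈ S, K.Sat (ρ x) w ∧ (ρ x).td < d) : Consistent A d S := by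
  induction d generalizing S w with
  | zero =>
    exact Set.eq_empty_of_forall_notMem fun x hx => absurd (hS x hx).2 (Nat.not_lt_zero _)
  | succ d ih =>
    refine ⟨{x | K.Sat (ρ x) w ∧ (ρ x).td < d + 1}, hS, ⟨?_, ?_, ?_, ?_, ?_⟩, ?_⟩
    · intro x hx h
      rw [hρ.const_iff] at h
      have := hx.1
      rw [h] at this
      exact this
    · intro x hx y h
      have h := hρ.conn_sound _ _ _ h
      obtain ⟨hs, ht⟩ := hx
      revert hs ht h
      cases ρ x <;> simp +contextual [ConnPos.arg, Kripke.Sat, Formula.td]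
    · intro x hx y h
      have h := hρ.conn_sound _ _ _ h
      obtain ⟨hs, ht⟩ := hx
      revert hs ht h
      cases ρ x <;> simp +contextual [ConnPos.arg, Kripke.Sat, Formula.td]
    · intro x hx y z h h'
      have h := hρ.conn_sound _ _ _ h
      have h' := hρ.conn_sound _ _ _ h'
      obtain ⟨hs, ht⟩ := hx
      revert hs ht h h'
      cases ρ x <;> simp +contextual [ConnPos.arg, Kripke.Sat, Formula.td]
    · intro x hx y h hy
      have h := hρ.conn_sound _ _ _ h
      obtain ⟨hs, ht⟩ := hx
      have hy := hy.1
      revert hs h hy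
      cases ρ x <;> simp +contextual [ConnPos.arg, Kripke.Sat]
    · rintro U ⟨e, hU⟩
      -- The successor serves `e`: a witness if `e` represents a true `EX`-formula, and otherwise
      -- any successor, for which the condition on `e` is vacuous.
      obtain ⟨v, hv, he⟩ : ∃ v, K.R w v ∧ ∀ y, RelMap (L := tau) (TauRel.bodyUn .E .X) ![y, e] →
          K.Sat (ρ e) w → K.Sat (ρ y) v := by
        by_cases h : ∃ ψ, ρ e = .un .E .X ψ ∧ K.Sat (ρ e) w
        · obtain ⟨ψ, hψ, hs⟩ := h
          rw [hψ, K.sat_EX] at hs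
          obtain ⟨v, hv, hs⟩ := hs
          refine ⟨v, hv, fun y hy _ => ?_⟩
          have := (hρ.bodyUn_sound _ _ _ _ hy).symm.trans hψ
          simp only [Formula.un.injEq, true_and] at this
          rwa [this]
        · obtain ⟨v, hv⟩ := K.total w
          exact ⟨v, hv, fun y hy hs => absurd ⟨_, hρ.bodyUn_sound _ _ _ _ hy, hs⟩ h⟩
      refine ih (w := v) fun y hy => ?_
      rcases hU hy with ⟨x, ⟨hs, ht⟩, h⟩ | ⟨⟨hs, ht⟩, h⟩
      · have := hρ.bodyUn_sound _ _ _ _ h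
        rw [this] at hs ht
        exact ⟨(K.sat_AX _ _).1 hs v hv, by simpa [Formula.td] using ht⟩
      · refine ⟨he y h hs, ?_⟩
        rw [hρ.bodyUn_sound _ _ _ _ h] at ht
        simpa [Formula.td] using ht

/-- The model is a tree of guesses: one successor of the root for each element `e`, taken from a
model of the demand for `e`. Finiteness of `A` keeps the model finite, and indexing by all of `A`
gives the root a successor even if `T` has no `EX`-elements. -/
theorem IsEncoding.exists_sat [Finite A] (hρ : IsEncoding φ A ρ)
    (hφ : φ ∈ NNF {opAX, opEX}) {d : ℕ} {S : Set A} (hS : Consistent A d S) :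
    ∃ (K : Kripke) (w : K.W), ∀ x ∈ S, K.Sat (ρ x) w := by
  induction d generalizing S with
  | zero =>
    -- Nothing is demanded, but a world must exist to serve as a successor; a single reflexive one
    -- will do.
    refine ⟨⟨Unit, inferInstance, fun _ _ => True, fun _ => ⟨(), trivial⟩, fun _ => ∅⟩, (), ?_⟩
    simp [show S = ∅ from hS]
  | succ d ih =>
    obtain ⟨T, hST, hT, hU⟩ := hS
    have : Nonempty A := ⟨(hρ.surj φ φ.self_mem_SF).choose⟩
    choose K w hK using fun e => ih (hU (demand A T e) ⟨e, subset_rfl⟩)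
    have hO : ∀ x, (ρ x).UsesOnly {opAX, opEX} := fun x => hφ.2.of_mem_SF (hρ.mem_SF x)
    have hN : ∀ x, (ρ x).IsNNF := fun x => hφ.1.of_mem_SF (hρ.mem_SF x)
    let P : Set ℕ := {p | ∃ x ∈ T, ρ x = .var p}
    -- Truth lemma at the new root. Only membership in `T` implies truth; the converse may fail.
    suffices h : ∀ ψ, ∀ x ∈ T, ρ x = ψ → (Kripke.join K w P).Sat ψ none from
      ⟨Kripke.join K w P, none, fun x hx => h _ x (hST hx) rfl⟩
    intro ψ
    induction ψ with
    | top => exact fun _ _ _ => trivial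
    | bot => exact fun x hx h => hT.bot x hx ((hρ.const_iff _ _).2 h)
    | var p => exact fun x hx h => ⟨x, hx, h⟩
    | neg ψ =>
      intro x hx h
      obtain ⟨p, rfl⟩ : ∃ p, ψ = .var p := by simpa [h, Formula.IsNNF] using hN x
      -- If `p` held at the root, some `z` in `T` would represent it. Uniqueness of representatives
      -- makes `z` the argument of the negation, which saturation excludes from `T`.
      rintro ⟨z, hz, hzp⟩
      obtain ⟨y, hy, -⟩ := hρ.conn_complete .not₁ x (.var p) (by rw [h]; rfl)
      have hyp : ρ y = .var p := by
        have := hρ.conn_sound _ _ _ hy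
        rw [h] at this
        exact (Option.some.inj this).symm
      exact hT.neg x hx y hy (hρ.var_unique p z y hzp hyp ▸ hz)
    | and ψ χ ih ih' =>
      intro x hx h
      obtain ⟨y, hy, -⟩ := hρ.conn_complete .and₁ x ψ (by rw [h]; rfl)
      obtain ⟨z, hz, -⟩ := hρ.conn_complete .and₂ x χ (by rw [h]; rfl)
      have hy' := hρ.conn_sound _ _ _ hy
      have hz' := hρ.conn_sound _ _ _ hz
      rw [h] at hy' hz'
      exact ⟨ih y (hT.and₁ x hx y hy) (Option.some.inj hy').symm,
        ih' z (hT.and₂ x hx z hz) (Option.some.inj hz').symm⟩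
    | or ψ χ ih ih' =>
      intro x hx h
      obtain ⟨y, hy, -⟩ := hρ.conn_complete .or₁ x ψ (by rw [h]; rfl)
      obtain ⟨z, hz, -⟩ := hρ.conn_complete .or₂ x χ (by rw [h]; rfl)
      have hy' := hρ.conn_sound _ _ _ hy
      have hz' := hρ.conn_sound _ _ _ hz
      rw [h] at hy' hz'
      exact (hT.or x hx y z hy hz).imp (fun hyT => ih y hyT (Option.some.inj hy').symm)
        (fun hzT => ih' z hzT (Option.some.inj hz').symm)
    | un q t ψ =>
      intro x hx h
      obtain ⟨y, hy, -⟩ := hρ.bodyUn_complete q t x ψ h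
      have hyψ : ρ y = ψ := by
        have := (hρ.bodyUn_sound _ _ _ _ hy).symm.trans h
        simpa using this
      have hψ := hyψ ▸ hO y
      obtain ⟨rfl | rfl, rfl⟩ := (h ▸ hO x).un_cases
      -- The argument of an `AX`-element of `T` belongs to the demand for every index `i`.
      · refine (Kripke.sat_AX _ _ _).2 ?_
        rintro _ ⟨i, rfl⟩
        exact (Kripke.sat_join_iff K w P hψ i _).2 (hyψ ▸ hK i y (Or.inl ⟨x, hx, hy⟩))
      -- The successor indexed by the `EX`-element `x` itself is the witness.
      · exact (Kripke.sat_EX _ _ _).2 ⟨_, ⟨x, rfl⟩,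
          (Kripke.sat_join_iff K w P hψ x _).2 (hyψ ▸ hK x y (Or.inr ⟨hx, hy⟩))⟩
    | bin q ψ χ => exact fun x _ h => absurd (h ▸ hO x) Formula.UsesOnly.not_bin

end Consistent

/-! ### The sentences -/

/-- The implication `θ → η`. -/
def imp (θ η : MSO tau) : MSO tau := .or (.neg θ) η

/-- The atomic formula `r(x)`. -/
def rel₁ (r : TauRel 1) (x : ℕ) : MSO tau := MSO.rel (L := tau) r ![x]

/-- The atomic formula `r(x, y)`. -/
def rel₂ (r : TauRel 2) (x y : ℕ) : MSO tau := MSO.rel (L := tau) r ![x, y]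

/-- The set `X₀` is contained in the saturated set `X₁`. -/
def saturatedSuperset : MSO tau :=
  .and (.all 0 (imp (.mem 0 0) (.mem 0 1))) <| .all 0 <| imp (.mem 0 1) <|
    .and (.neg (rel₁ (.const false) 0)) <|
    .and (.all 1 (imp (rel₂ (.conn .and₁) 1 0) (.mem 1 1))) <|
    .and (.all 1 (imp (rel₂ (.conn .and₂) 1 0) (.mem 1 1))) <|
    .and (.all 1 (.all 2 (imp (rel₂ (.conn .or₁) 1 0)
      (imp (rel₂ (.conn .or₂) 2 0) (.or (.mem 1 1) (.mem 2 1)))))) <|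
    .all 1 (imp (rel₂ (.conn .not₁) 1 0) (.neg (.mem 1 1)))

/-- The set `X₀` is contained in the demand of `X₁` on the successor for some element. -/
def subsetDemand : MSO tau :=
  .ex 0 <| .all 1 <| imp (.mem 1 0) <|
    .or (.ex 2 (.and (.mem 2 1) (rel₂ (.bodyUn .A .X) 1 2)))
      (.and (.mem 0 1) (rel₂ (.bodyUn .E .X) 1 0))

/-- The set `X₀` is consistent. -/
def consistentFormula : ℕ → MSO tau
  | 0 => .all 0 (.neg (.mem 0 0))
  | d + 1 => .exSet 1 (.and saturatedSuperset
      (.allSet 0 (imp subsetDemand (consistentFormula d))))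

/-- Some consistent set contains the element that represents the whole formula. -/
def satSentence (d : ℕ) : MSO tau :=
  .exSet 0 (.and (.all 0 (imp (rel₁ .repr 0) (.mem 0 0))) (consistentFormula (d + 1)))

section Sat

variable {A : Type} [tau.Structure A] (v : ℕ → A) (V : ℕ → Set A)

theorem sat_imp (θ η : MSO tau) : (imp θ η).Sat A v V ↔ (θ.Sat A v V → η.Sat A v V) := by
  simp [imp, MSO.Sat, imp_iff_not_or]

theorem sat_rel₁ (r : TauRel 1) (x : ℕ) :
    (rel₁ r x).Sat A v V ↔ RelMap (L := tau) r ![v x] := by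
  have : (fun i => v (![x] i)) = ![v x] := by ext i; fin_cases i; rfl
  simp only [rel₁, MSO.Sat, this]

theorem sat_rel₂ (r : TauRel 2) (x y : ℕ) :
    (rel₂ r x y).Sat A v V ↔ RelMap (L := tau) r ![v x, v y] := by
  have : (fun i => v (![x, y] i)) = ![v x, v y] := by ext i; fin_cases i <;> rfl
  simp only [rel₂, MSO.Sat, this]

theorem sat_saturatedSuperset :
    saturatedSuperset.Sat A v V ↔ V 0 ⊆ V 1 ∧ IsSaturated A (V 1) := by
  simp only [saturatedSuperset, MSO.Sat, sat_imp, sat_rel₁, sat_rel₂, Function.update_self, ne_eq,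
    zero_ne_one, OfNat.zero_ne_ofNat, OfNat.one_ne_ofNat, not_false_eq_true, Function.update_of_ne]
  refine and_congr Iff.rfl ⟨fun h => ?_, fun h x hx => ?_⟩
  · exact ⟨fun x hx => (h x hx).1, fun x hx => (h x hx).2.1, fun x hx => (h x hx).2.2.1,
      fun x hx => (h x hx).2.2.2.1, fun x hx => (h x hx).2.2.2.2⟩
  · exact ⟨h.bot x hx, h.and₁ x hx, h.and₂ x hx, h.or x hx, h.neg x hx⟩

theorem sat_subsetDemand :
    subsetDemand.Sat A v V ↔ ∃ e, V 0 ⊆ demand A (V 1) e := by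
  simp only [subsetDemand, MSO.Sat, sat_imp, sat_rel₂, Function.update_self, ne_eq,
    zero_ne_one, OfNat.one_ne_ofNat, not_false_eq_true, Function.update_of_ne]
  rfl

/-- Two set variables suffice at every depth: once `X₁` is guessed, `X₀` is no longer needed and is
quantified anew. Hence the induction must vary `V`. -/
theorem sat_consistentFormula (d : ℕ) :
    (consistentFormula d).Sat A v V ↔ Consistent A d (V 0) := by
  induction d generalizing V with
  | zero => simp [consistentFormula, MSO.Sat, Consistent, Set.eq_empty_iff_forall_notMem]
  | succ d ih =>
    simp only [consistentFormula, MSO.Sat, sat_imp, sat_saturatedSuperset, sat_subsetDemand, ih,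
      Consistent, Function.update_self, ne_eq, zero_ne_one, one_ne_zero, not_false_eq_true,
      Function.update_of_ne, and_assoc]

theorem sat_satSentence (d : ℕ) : (satSentence d).Sat A v V ↔
    ∃ S : Set A, (∀ x, RelMap (L := tau) TauRel.repr ![x] → x ∈ S) ∧ Consistent A (d + 1) S := by
  simp only [satSentence, MSO.Sat, sat_imp, sat_rel₁, sat_consistentFormula, Function.update_self]

end Sat

theorem IsEncoding.satisfiable_iff {A : Type} [Finite A] [tau.Structure A] {φ : Formula}
    {ρ : A → Formula} (hρ : IsEncoding φ A ρ) (hφ : φ ∈ NNF {opAX, opEX}) :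
    φ.Satisfiable ↔ (satSentence φ.td).HoldsIn A := by
  obtain ⟨x, hx⟩ := hρ.surj φ φ.self_mem_SF
  constructor
  · rintro ⟨K, w, h⟩ v V
    -- The formula has depth `φ.td`, so the strict depth bound is `φ.td + 1`.
    refine (sat_satSentence v V _).2 ⟨{x | ρ x = φ}, fun x hx => (hρ.repr_iff x).1 hx,
      hρ.consistent K (w := w) ?_⟩
    rintro x rfl
    exact ⟨h, Nat.lt_succ_self _⟩
  · intro h
    obtain ⟨S, hS, hc⟩ := (sat_satSentence _ _ _).1 (h (fun _ => x) fun _ => ∅)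
    obtain ⟨K, w, hK⟩ := hρ.exists_sat hφ hc
    exact ⟨K, w, hx ▸ hK x (hS x ((hρ.repr_iff x).2 hx))⟩

theorem freeVars_consistentFormula (d : ℕ) : (consistentFormula d).freeVars = ∅ := by
  induction d with
  | zero => simp [consistentFormula, MSO.freeVars]
  | succ d ih =>
    simp only [consistentFormula, saturatedSuperset, subsetDemand, imp, rel₁, rel₂, MSO.freeVars,
      ih, Matrix.range_cons, Matrix.range_empty]
    ext n
    simp

theorem freeSetVars_consistentFormula (d : ℕ) : (consistentFormula d).freeSetVars ⊆ {0} := by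
  induction d with
  | zero => simp [consistentFormula, MSO.freeSetVars]
  | succ d ih =>
    simp only [consistentFormula, saturatedSuperset, subsetDemand, imp, rel₁, rel₂,
      MSO.freeSetVars]
    intro n
    have := @ih n
    simp at this ⊢
    grind

theorem isSentence_satSentence (d : ℕ) : (satSentence d).IsSentence := by
  constructor
  · simp [satSentence, imp, rel₁, MSO.freeVars, freeVars_consistentFormula]
  · simpa [satSentence, imp, rel₁, MSO.freeSetVars, Set.sdiff_eq_empty]
      using freeSetVars_consistentFormula (d + 1)

/-- Each depth wraps the previous formula in the same context, so the Gödel numbers arise by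
iterating one fixed primitive recursive function. -/
theorem primrec_msoCode_consistentFormula : Primrec fun d => msoCode (consistentFormula d) := by
  have hp : ∀ n : ℕ, ∀ {f : ℕ → ℕ}, Primrec f → Primrec fun c => Nat.pair n (f c) :=
    fun n f hf => Primrec₂.natPair.comp (Primrec.const n) hf
  have hstep : Primrec fun c => Nat.pair 8 (Nat.pair 1 (Nat.pair 4
      (Nat.pair (msoCode saturatedSuperset) (Nat.pair 9 (Nat.pair 0 (Nat.pair 5
        (Nat.pair (Nat.pair 3 (msoCode subsetDemand)) c))))))) :=
    hp _ <| hp _ <| hp _ <| hp _ <| hp _ <| hp _ <| hp _ <| hp _ Primrec.id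
  refine (Primrec.nat_rec₁ (msoCode (consistentFormula 0))
    (hstep.comp₂ Primrec₂.right)).of_eq fun d => ?_
  induction d with
  | zero => rfl
  | succ d ih =>
    simp only at ih ⊢
    rw [ih]
    rfl

theorem computable_msoCode_satSentence : Computable fun d => msoCode (satSentence d) := by
  have hp : ∀ n : ℕ, ∀ {f : ℕ → ℕ}, Primrec f → Primrec fun c => Nat.pair n (f c) :=
    fun n f hf => Primrec₂.natPair.comp (Primrec.const n) hf
  exact Primrec.to_comp <| hp 8 <| hp 0 <| hp 4 <|
    hp (msoCode (.all 0 (imp (rel₁ .repr 0) (.mem 0 0)))) <|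
      primrec_msoCode_consistentFormula.comp Primrec.succ

end CTL

/-- There is a computable family `θ 0, θ 1, …` of MSO sentences such that each formula `φ` in
negation normal form over `AX`, `EX` is satisfiable iff the structure `A_φ` (equivalently, any
finite structure that encodes `φ`) satisfies the sentence `θ (td φ)`. -/
theorem mainTheorem3 :
    ∃ θ : ℕ → MSO CTL.tau,
      Computable (fun d => CTL.msoCode (θ d)) ∧
      (∀ d, (θ d).IsSentence) ∧
      ∀ φ ∈ CTL.NNF {CTL.opAX, CTL.opEX},
        (φ.Satisfiable ↔ (θ φ.td).HoldsIn φ.Univ) ∧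
        ∀ (A : Type) [Finite A] [CTL.tau.Structure A] (ρ : A → CTL.Formula),
          CTL.IsEncoding φ A ρ → (φ.Satisfiable ↔ (θ φ.td).HoldsIn A) := by
  exact ⟨CTL.satSentence, CTL.computable_msoCode_satSentence, CTL.isSentence_satSentence,
    fun φ hφ => ⟨haveI := CTL.finite_univ φ; (CTL.isEncoding_univ φ).satisfiable_iff hφ,
      fun _ _ _ _ hρ => hρ.satisfiable_iff hφ⟩⟩
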